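/- There exists a planar, locally finite, connected graph $G$ that has tree-width $<\aleph_0$ (that is, $G$ has a tree-decomposition into finite parts) but admits no lean tree-decomposition whatsoever, whether into finite or infinite parts. In particular, not every graph of tree-width $<\aleph_0$ has a lean tree-decomposition into finite parts, and not every such graph has a lean tree-decomposition at all. Here a graph is planar if it can be drawn in the plane $\mathbb R^2$ with distinct points as vertices and with arcs between their endvertices as edges, such that no arc contains a vertex other than its endvertices and distinct arcs meet at most in common endvertices. A tree-decomposition of $G$ is a pair $(T,(V_t)_{t\in T})$ of a tree $T$ (possibly infinite) and vertex sets $V_t\subseteq V(G)$ (its parts, possibly infinite) such that every vertex of $G$ lies in some $V_t$, every edge of $G$ has both endvertices in some $V_t$, and $V_s\cap V_t\subseteq V_r$ whenever $r$ lies on the path $sTt$ in $T$ between $s$ and $t$. It is lean if for every two (not necessarily distinct) nodes $s,t\in T$ and all sets $Z_s\subseteq V_s$ and $Z_t\subseteq V_t$ with $|Z_s|=|Z_t|=:\ell\in\mathbb N$, either $G$ contains $\ell$ pairwise vertex-disjoint $Z_s$--$Z_t$ paths (paths having precisely their first vertex in $Z_s$ and precisely their last vertex in $Z_t$; a single vertex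 of $Z_s\cap Z_t$ is allowed), or some edge $xy$ of $sTt$ satisfies $|V_x\cap V_y|<\ell$. -/

import Mathlib

universe u

namespace LeanTD

/-- `p` is an `A`--`B` path: a path whose first vertex is its only vertex in `A` and
whose last vertex is its only vertex in `B`. Paths of length `0` are allowed. -/
def IsABPath {V : Type*} {G : SimpleGraph V} (A B : Set V) {a b : V} (p : G.Walk a b) : Prop :=
  p.IsPath ∧ (∀ v ∈ p.support, v ∈ A ↔ v = a) ∧ (∀ v ∈ p.support, v ∈ B ↔ v = b)

/-- `G` contains `n` pairwise (vertex-)disjoint `A`--`B` paths. -/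
def HasDisjointPaths {V : Type*} (G : SimpleGraph V) (A B : Set V) (n : ℕ) : Prop :=
  ∃ (a b : Fin n → V) (p : ∀ i, G.Walk (a i) (b i)),
    (∀ i, IsABPath A B (p i)) ∧
      ∀ i j, i ≠ j → ∀ v, v ∈ (p i).support → v ∉ (p j).support

/-- `(T, bag)` is a tree-decomposition of `G`: `T` is a tree, the bags cover all vertices
and all edges of `G`, and `bag s ∩ bag t ⊆ bag r` for all nodes `r` on the path `sTt`. -/
structure IsTreeDecomposition {V : Type*} (G : SimpleGraph V) {N : Type*} (T : SimpleGraph N)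
    (bag : N → Set V) : Prop where
  isTree : T.IsTree
  vertex_mem : ∀ v, ∃ t, v ∈ bag t
  edge_mem : ∀ v w, G.Adj v w → ∃ t, v ∈ bag t ∧ w ∈ bag t
  inter_subset : ∀ (s t : N) (p : T.Walk s t), p.IsPath → ∀ r ∈ p.support, bag s ∩ bag t ⊆ bag r

/-- The leanness condition: for all nodes `s`, `t` (possibly equal) and finite sets
`Zs ⊆ bag s`, `Zt ⊆ bag t` of the same size `ℓ`, either `G` contains `ℓ` disjoint `Zs`--`Zt`
paths, or some edge `xy` of the path `sTt` has an adhesion set `bag x ∩ bag y` of size `< ℓ`. -/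
def IsLean {V : Type*} (G : SimpleGraph V) {N : Type*} (T : SimpleGraph N)
    (bag : N → Set V) : Prop :=
  ∀ (s t : N) (Zs Zt : Finset V), (Zs : Set V) ⊆ bag s → (Zt : Set V) ⊆ bag t →
    Zs.card = Zt.card →
      HasDisjointPaths G (Zs : Set V) (Zt : Set V) Zs.card ∨
        ∃ p : T.Walk s t, p.IsPath ∧
          ∃ d ∈ p.darts, (bag d.fst ∩ bag d.snd).encard < (Zs.card : ℕ∞)

/-- `A` is an arc in the plane with the endpoints `x` and `y`. -/
def IsArc (A : Set (ℝ × ℝ)) (x y : ℝ × ℝ) : Prop :=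
  ∃ γ : Path x y, Function.Injective γ ∧ Set.range γ = A

/-- `G` is planar: it can be drawn in the plane with its vertices as distinct points and its
edges as arcs between their endvertices, such that an arc contains no vertices other than its
endvertices, and two distinct arcs meet only in common endvertices. -/
def IsPlanar {V : Type*} (G : SimpleGraph V) : Prop :=
  ∃ (pos : V → ℝ × ℝ) (arc : Sym2 V → Set (ℝ × ℝ)),
    Function.Injective pos ∧
    (∀ v w, G.Adj v w → IsArc (arc s(v, w)) (pos v) (pos w)) ∧
    (∀ e ∈ G.edgeSet, ∀ v, pos v ∈ arc e → v ∈ e) ∧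
    (∀ e ∈ G.edgeSet, ∀ f ∈ G.edgeSet, e ≠ f →
      ∀ x ∈ arc e ∩ arc f, ∃ v, v ∈ e ∧ v ∈ f ∧ pos v = x)

/-- Every vertex of `G` has finite degree. -/
def IsLocallyFinite {V : Type*} (G : SimpleGraph V) : Prop :=
  ∀ v, (G.neighborSet v).Finite

/-- `G` has tree-width `< ℵ₀`: it has a tree-decomposition into finite parts. -/
def HasFiniteTreeWidth {V : Type*} (G : SimpleGraph V) : Prop :=
  ∃ (N : Type) (T : SimpleGraph N) (bag : N → Set V),
    IsTreeDecomposition G T bag ∧ ∀ t, (bag t).Finite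

end LeanTD

/-! The counterexample `stripGraph` is a half-plane grid with edges deleted. Its upper quadrant is
intact; below it hang strips of widths `7 * 2 ^ j`. Strip `j` is joined to strip `j + 1` through a
door of `2 * 2 ^ j` edges and to the upper quadrant through `2 ^ j` contact edges. Strips `0, …, i`
are cut off from the rest by door `i` and contacts `0, …, i`, hence by fewer than `4 * 2 ^ i`
vertices, while every strip contains arbitrarily well connected grids.

In any tree-decomposition, Helly's theorem for subtrees gives for each `j` a node `t j` whose bag
captures a square of strip `j` (`IsTreeDecomposition.exists_meetsSquare`). As bags `t i` and `t (i +
1)` contain `4 * 2 ^ i` vertices of their strips, leanness yields an edge `e i` between these nodes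
with adhesion set `X` of size less than `4 * 2 ^ i` (`IsLean.exists_dart`).

Such an `X` has little freedom (`HeightLt.linkedDeep_of_cut`). It must spend at least half its
budget on door `i`, so it cannot block the contacts of strip `i + 1`. It must then block the
contacts of strip `i`, and too little is left for door `i - 1`; so strip `i - 1` is on the side of
strip `i` and its contacts must be blocked too, and so on down to strip `0`. Hence `X` leaves all
strips up to `i` together with `(7, -1)` on one side, and strip `i + 1` with `(7, 0)` on the other.

If bags `u`, `v` contain these two vertices, all `e i` therefore lie on the finite path `uTv`. They
are distinct, since `t (i + 1)` lies on the side of `v` for `e i` but on that of `u` for every later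
edge: a contradiction. -/

namespace LeanTD

open SimpleGraph

/-! ### Sides of a tree edge, and the Helly property of subtrees -/

section Tree

variable {N : Type*} {T : SimpleGraph N}

/-- `s` and `t` are joined by a walk that does not use the edge `e`. -/
def SameSide (T : SimpleGraph N) (e : Sym2 N) (s t : N) : Prop :=
  ∃ p : T.Walk s t, e ∉ p.edges

lemma SameSide.symm {e : Sym2 N} {s t : N} (h : SameSide T e s t) : SameSide T e t s := by
  obtain ⟨p, hp⟩ := h
  exact ⟨p.reverse, by simpa using hp⟩

lemma SameSide.trans {e : Sym2 N} {s t r : N} (h : SameSide T e s t) (h' : SameSide T e t r) :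
    SameSide T e s r := by
  obtain ⟨p, hp⟩ := h
  obtain ⟨q, hq⟩ := h'
  exact ⟨p.append q, by simp [Walk.edges_append, hp, hq]⟩

lemma eq_bypass_of_isPath [DecidableEq N] (hT : T.IsTree) {s t : N} {p : T.Walk s t}
    (hp : p.IsPath) (w : T.Walk s t) : p = w.bypass :=
  (hT.existsUnique_path s t).unique hp w.bypass_isPath

lemma support_subset_of_isPath (hT : T.IsTree) {s t : N} {p : T.Walk s t} (hp : p.IsPath)
    (w : T.Walk s t) : p.support ⊆ w.support := by
  classical
  rw [eq_bypass_of_isPath hT hp w]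
  exact w.support_bypass_subset_support

lemma edges_subset_of_isPath (hT : T.IsTree) {s t : N} {p : T.Walk s t} (hp : p.IsPath)
    (w : T.Walk s t) : p.edges ⊆ w.edges := by
  classical
  rw [eq_bypass_of_isPath hT hp w]
  exact w.edges_bypass_subset_edges

lemma not_sameSide_iff (hT : T.IsTree) {s t : N} {p : T.Walk s t} (hp : p.IsPath) (e : Sym2 N) :
    ¬ SameSide T e s t ↔ e ∈ p.edges := by
  constructor
  · intro h
    by_contra h'
    exact h ⟨p, h'⟩
  · rintro h ⟨w, hw⟩
    exact hw (edges_subset_of_isPath hT hp w h)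

lemma exists_isPath (hT : T.IsTree) (s t : N) : ∃ p : T.Walk s t, p.IsPath :=
  (hT.existsUnique_path s t).exists

/-- A set of nodes that contains all paths between its elements. -/
def PathConvex (T : SimpleGraph N) (S : Set N) : Prop :=
  ∀ s ∈ S, ∀ t ∈ S, ∀ p : T.Walk s t, p.IsPath → ∀ r ∈ p.support, r ∈ S

lemma PathConvex.inter {A B : Set N} (hA : PathConvex T A) (hB : PathConvex T B) :
    PathConvex T (A ∩ B) :=
  fun s hs t ht p hp r hr => ⟨hA s hs.1 t ht.1 p hp r hr, hB s hs.2 t ht.2 p hp r hr⟩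

lemma PathConvex.exists_mem_inter_of_walk (hT : T.IsTree) {A B C : Set N} (hA : PathConvex T A)
    (hB : PathConvex T B) (hC : PathConvex T C) {q : N} (hqB : q ∈ B) (hqC : q ∈ C) {r p : N}
    (w : T.Walk r p) (hw : w.IsPath) (hr : r ∈ A ∩ C) (hp : p ∈ A ∩ B) : (A ∩ B ∩ C).Nonempty := by
  induction w with
  | nil => exact ⟨_, hp, hr.2⟩
  | @cons r r' p hadj w ih =>
    by_cases hrB : r ∈ B
    · exact ⟨r, ⟨hr.1, hrB⟩, hr.2⟩
    have hw' := (Walk.cons_isPath_iff _ _).1 hw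
    have hr'A : r' ∈ A := hA r hr.1 p hp.1 _ hw r' (by simp)
    refine ih hw'.1 ⟨hr'A, ?_⟩ hp
    obtain ⟨v, hv⟩ := exists_isPath hT r q
    -- Either `r'` lies on the path from `r` to `q`, hence in `C`, or the edge `r r'` separates `p`
    -- from `q`, and the path between them puts `r` into `B`.
    by_cases he : s(r, r') ∈ v.edges
    · exact hC r hr.2 q hqC v hv r' (Walk.snd_mem_support_of_mem_edges _ he)
    exfalso
    obtain ⟨z, hz⟩ := exists_isPath hT p q
    have hps : SameSide T s(r, r') r' p :=
      ⟨w, fun h => hw'.2 (Walk.fst_mem_support_of_mem_edges _ h)⟩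
    have hns : ¬ SameSide T s(r, r') p q := fun h => by
      have h1 : SameSide T s(r, r') r r' := (SameSide.trans ⟨v, he⟩ h.symm).trans hps.symm
      exact (not_sameSide_iff hT (p := Walk.cons hadj Walk.nil) (by simp [hadj.ne]) _).2
        (by simp) h1
    exact hrB (hB p hp.2 q hqB z hz r
      (Walk.fst_mem_support_of_mem_edges _ ((not_sameSide_iff hT hz _).1 hns)))

lemma PathConvex.inter_nonempty (hT : T.IsTree) {A B C : Set N} (hA : PathConvex T A)
    (hB : PathConvex T B) (hC : PathConvex T C) (hAB : (A ∩ B).Nonempty) (hBC : (B ∩ C).Nonempty)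
    (hAC : (A ∩ C).Nonempty) : (A ∩ B ∩ C).Nonempty := by
  obtain ⟨p, hp⟩ := hAB
  obtain ⟨q, hq⟩ := hBC
  obtain ⟨r, hr⟩ := hAC
  obtain ⟨w, hw⟩ := exists_isPath hT r p
  exact hA.exists_mem_inter_of_walk hT hB hC hq.1 hq.2 w hw hr hp

/-- The Helly property of subtrees. -/
lemma PathConvex.exists_forall_mem (hT : T.IsTree) {ι : Type*} (F : Finset ι) :
    ∀ S : ι → Set N, (∀ i ∈ F, PathConvex T (S i)) →
      (∀ i ∈ F, ∀ j ∈ F, (S i ∩ S j).Nonempty) → ∃ t, ∀ i ∈ F, t ∈ S i := by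
  classical
  induction F using Finset.induction_on with
  | empty =>
    intro S _ _
    have := hT.connected.nonempty
    exact ⟨Classical.arbitrary N, by simp⟩
  | insert a F ha ih =>
    intro S hS hne
    rcases F.eq_empty_or_nonempty with rfl | ⟨b, hb⟩
    · obtain ⟨t, ht⟩ := hne a (by simp) a (by simp)
      exact ⟨t, by simpa using ht.1⟩
    -- Intersecting every set with `S a` keeps them convex; they still meet pairwise by the
    -- three-set case.
    obtain ⟨t, ht⟩ := ih (fun i => S i ∩ S a)
      (fun i hi => (hS i (by simp [hi])).inter (hS a (by simp)))
      (fun i hi j hj => by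
        obtain ⟨t, ht⟩ := PathConvex.inter_nonempty hT (hS i (by simp [hi])) (hS j (by simp [hj]))
          (hS a (by simp)) (hne i (by simp [hi]) j (by simp [hj]))
          (hne j (by simp [hj]) a (by simp)) (hne i (by simp [hi]) a (by simp))
        exact ⟨t, ⟨ht.1.1, ht.2⟩, ht.1.2, ht.2⟩)
    refine ⟨t, fun i hi => ?_⟩
    rcases Finset.mem_insert.1 hi with rfl | hi
    · exact (ht b hb).2
    · exact (ht i hi).1

end Tree

/-! ### Separation and brambles in tree-decompositions -/

section Decomposition

variable {V : Type*} {G : SimpleGraph V} {N : Type*} {T : SimpleGraph N} {bag : N → Set V}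

/-- `a` and `b` are joined by a walk that avoids `X`. -/
def Linked (G : SimpleGraph V) (X : Set V) (a b : V) : Prop :=
  ∃ w : G.Walk a b, ∀ v ∈ w.support, v ∉ X

lemma Linked.refl {X : Set V} {a : V} (h : a ∉ X) : Linked G X a a := ⟨.nil, by simpa using h⟩

lemma Linked.symm {X : Set V} {a b : V} (h : Linked G X a b) : Linked G X b a := by
  obtain ⟨w, hw⟩ := h
  exact ⟨w.reverse, by simpa using hw⟩

lemma Linked.trans {X : Set V} {a b c : V} (h : Linked G X a b) (h' : Linked G X b c) :
    Linked G X a c := by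
  obtain ⟨w, hw⟩ := h
  obtain ⟨w', hw'⟩ := h'
  refine ⟨w.append w', fun v hv => ?_⟩
  rcases Walk.mem_support_append_iff _ _ |>.1 hv with hv | hv
  exacts [hw v hv, hw' v hv]

lemma Linked.of_adj {X : Set V} {a b : V} (h : G.Adj a b) (ha : a ∉ X) (hb : b ∉ X) :
    Linked G X a b :=
  ⟨.cons h .nil, by simp [ha, hb]⟩

lemma IsTreeDecomposition.sameSide_of_mem (h : IsTreeDecomposition G T bag) {x y s t : N} {a : V}
    (ha : a ∉ bag x ∩ bag y) (hs : a ∈ bag s) (ht : a ∈ bag t) : SameSide T s(x, y) s t := by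
  obtain ⟨p, hp⟩ := exists_isPath h.isTree s t
  refine ⟨p, fun he => ha ⟨?_, ?_⟩⟩
  · exact h.inter_subset s t p hp x (Walk.fst_mem_support_of_mem_edges _ he) ⟨hs, ht⟩
  · exact h.inter_subset s t p hp y (Walk.snd_mem_support_of_mem_edges _ he) ⟨hs, ht⟩

/-- A vertex outside the adhesion set has all its bags on one side of `xy`, and consecutive vertices
of a walk share a bag. -/
lemma IsTreeDecomposition.sameSide_of_linked (h : IsTreeDecomposition G T bag) {x y s t : N}
    {a b : V} (hab : Linked G (bag x ∩ bag y) a b) (hs : a ∈ bag s) (ht : b ∈ bag t) :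
    SameSide T s(x, y) s t := by
  obtain ⟨w, hw⟩ := hab
  induction w generalizing s with
  | nil => exact h.sameSide_of_mem (hw _ (by simp)) hs ht
  | @cons a a' b hadj w ih =>
    obtain ⟨q, hq, hq'⟩ := h.edge_mem a a' hadj
    exact (h.sameSide_of_mem (hw a (by simp)) hs hq).trans
      (ih hq' ht (fun v hv => hw v (by simp [hv])))

/-- The nodes whose bags meet a connected set of vertices form a subtree. -/
lemma IsTreeDecomposition.exists_mem_bag_of_walk (h : IsTreeDecomposition G T bag) {a b : V}
    (w : G.Walk a b) {s t r : N} (hs : a ∈ bag s) (ht : b ∈ bag t) {p : T.Walk s t}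
    (hp : p.IsPath) (hr : r ∈ p.support) : ∃ v ∈ w.support, v ∈ bag r := by
  induction w generalizing s with
  | nil => exact ⟨_, by simp, h.inter_subset s t p hp r hr ⟨hs, ht⟩⟩
  | @cons a a' b hadj w ih =>
    obtain ⟨q, hq, hq'⟩ := h.edge_mem a a' hadj
    obtain ⟨p₁, hp₁⟩ := exists_isPath h.isTree s q
    obtain ⟨p₂, hp₂⟩ := exists_isPath h.isTree q t
    rcases Walk.mem_support_append_iff _ _ |>.1
      (support_subset_of_isPath h.isTree hp (p₁.append p₂) hr) with hr | hr
    · exact ⟨a, by simp, h.inter_subset s q p₁ hp₁ r hr ⟨hs, hq⟩⟩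
    · obtain ⟨v, hv, hvr⟩ := ih hq' ht hp₂ hr
      exact ⟨v, by simp [hv], hvr⟩

lemma IsTreeDecomposition.pathConvex (h : IsTreeDecomposition G T bag) {C : Set V}
    (hC : ∀ a ∈ C, ∀ b ∈ C, Linked G Cᶜ a b) : PathConvex T {t | (bag t ∩ C).Nonempty} := by
  rintro s ⟨a, has, haC⟩ t ⟨b, hbt, hbC⟩ p hp r hr
  obtain ⟨w, hw⟩ := hC a haC b hbC
  obtain ⟨v, hv, hvr⟩ := h.exists_mem_bag_of_walk w has hbt hp hr
  exact ⟨v, hvr, by simpa using hw v hv⟩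

/-- A finite bramble of pairwise intersecting connected sets is covered by some bag. -/
lemma IsTreeDecomposition.exists_bag_cover (h : IsTreeDecomposition G T bag) {ι : Type*}
    (F : Finset ι) (C : ι → Set V) (hC : ∀ i ∈ F, ∀ a ∈ C i, ∀ b ∈ C i, Linked G (C i)ᶜ a b)
    (hne : ∀ i ∈ F, ∀ j ∈ F, (C i ∩ C j).Nonempty) : ∃ t, ∀ i ∈ F, (bag t ∩ C i).Nonempty := by
  refine PathConvex.exists_forall_mem h.isTree F (fun i => {t | (bag t ∩ C i).Nonempty})
    (fun i hi => h.pathConvex (hC i hi)) fun i hi j hj => ?_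
  obtain ⟨v, hvi, hvj⟩ := hne i hi j hj
  obtain ⟨t, ht⟩ := h.vertex_mem v
  exact ⟨t, ⟨v, ht, hvi⟩, v, ht, hvj⟩

/-- If a set of fewer than `n` vertices meets every `A`--`B` walk, then there are no `n` disjoint
`A`--`B` paths. -/
lemma not_hasDisjointPaths {A B : Set V} {n : ℕ} (S : Finset V) (hS : S.card < n)
    (hsep : ∀ a ∈ A, ∀ b ∈ B, ∀ w : G.Walk a b, ∃ v ∈ w.support, v ∈ S) :
    ¬ HasDisjointPaths G A B n := by
  rintro ⟨a, b, p, hp, hdisj⟩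
  have ha : ∀ i, a i ∈ A := fun i => ((hp i).2.1 _ (Walk.start_mem_support _)).2 rfl
  have hb : ∀ i, b i ∈ B := fun i => ((hp i).2.2 _ (Walk.end_mem_support _)).2 rfl
  choose f hf hfS using fun i => hsep _ (ha i) _ (hb i) (p i)
  have hinj : Function.Injective f := by
    intro i j hij
    by_contra hne
    exact hdisj i j hne (f i) (hf i) (hij ▸ hf j)
  have := Finset.card_le_card_of_injOn (s := Finset.univ) (t := S) f (fun i _ => hfS i)
    hinj.injOn
  simp at this
  omega

end Decomposition

/-! ### Planarity and local finiteness of grid subgraphs -/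

section Grid

/-- `q` is the right or the upper neighbour of `p` in the grid. -/
def GridStep (p q : ℕ × ℤ) : Prop :=
  (q.1 = p.1 ∧ q.2 = p.2 + 1) ∨ (q.1 = p.1 + 1 ∧ q.2 = p.2)

/-- `G` is a subgraph of the half-plane grid. -/
def IsGridSubgraph (G : SimpleGraph (ℕ × ℤ)) : Prop :=
  ∀ p q, G.Adj p q → GridStep p q ∨ GridStep q p

/-- The point of the plane at which a vertex of the grid is drawn. -/
def gridPos (p : ℕ × ℤ) : ℝ × ℝ := (p.1, p.2)

lemma gridPos_injective : Function.Injective gridPos := by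
  rintro ⟨x, y⟩ ⟨x', y'⟩ h
  simpa [gridPos] using h

/-- The segment between the ends of an edge. -/
def gridArc (e : Sym2 (ℕ × ℤ)) : Set (ℝ × ℝ) := convexHull ℝ (gridPos '' {v | v ∈ e})

lemma gridArc_mk (v w : ℕ × ℤ) : gridArc s(v, w) = segment ℝ (gridPos v) (gridPos w) := by
  have : {u | u ∈ s(v, w)} = {v, w} := by ext; simp
  rw [gridArc, this, Set.image_pair, convexHull_pair]

lemma isArc_segment {x y : ℝ × ℝ} (h : x ≠ y) : IsArc (segment ℝ x y) x y := by
  refine ⟨⟨⟨fun t => AffineMap.lineMap x y (t : ℝ), by fun_prop⟩, by simp, by simp⟩, ?_, ?_⟩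
  · intro s t hst
    exact Subtype.ext (AffineMap.lineMap_injective ℝ h hst)
  · rw [segment_eq_image_lineMap]
    ext z
    constructor
    · rintro ⟨t, rfl⟩
      exact ⟨t, t.2, rfl⟩
    · rintro ⟨t, ht, rfl⟩
      exact ⟨⟨t, ht⟩, rfl⟩

lemma mem_segment_vertical {a b c : ℝ} {z : ℝ × ℝ} (h : z ∈ segment ℝ (a, b) (a, c)) (hbc : b ≤ c) :
    z.1 = a ∧ b ≤ z.2 ∧ z.2 ≤ c := by
  obtain ⟨s, t, hs, ht, hst, rfl⟩ := h
  simp only [Prod.smul_mk, smul_eq_mul, Prod.mk_add_mk]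
  obtain rfl : s = 1 - t := by linarith
  refine ⟨by ring, by nlinarith, by nlinarith⟩

lemma mem_segment_horizontal {a b c : ℝ} {z : ℝ × ℝ} (h : z ∈ segment ℝ (a, c) (b, c))
    (hab : a ≤ b) : z.2 = c ∧ a ≤ z.1 ∧ z.1 ≤ b := by
  obtain ⟨s, t, hs, ht, hst, rfl⟩ := h
  simp only [Prod.smul_mk, smul_eq_mul, Prod.mk_add_mk]
  obtain rfl : s = 1 - t := by linarith
  refine ⟨by ring, by nlinarith, by nlinarith⟩

/-- An edge of the grid is a vertical or a horizontal unit segment. -/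
lemma gridArc_cases {G : SimpleGraph (ℕ × ℤ)} (hG : IsGridSubgraph G) {e : Sym2 (ℕ × ℤ)}
    (he : e ∈ G.edgeSet) :
    (∃ (x : ℕ) (y : ℤ), e = s((x, y), (x, y + 1)) ∧
      ∀ z ∈ gridArc e, z.1 = x ∧ (y : ℝ) ≤ z.2 ∧ z.2 ≤ y + 1) ∨
    (∃ (x : ℕ) (y : ℤ), e = s((x, y), (x + 1, y)) ∧
      ∀ z ∈ gridArc e, z.2 = y ∧ (x : ℝ) ≤ z.1 ∧ z.1 ≤ x + 1) := by
  have key : ∀ p q, GridStep p q → e = s(p, q) →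
      (∃ (x : ℕ) (y : ℤ), e = s((x, y), (x, y + 1)) ∧
        ∀ z ∈ gridArc e, z.1 = x ∧ (y : ℝ) ≤ z.2 ∧ z.2 ≤ y + 1) ∨
      (∃ (x : ℕ) (y : ℤ), e = s((x, y), (x + 1, y)) ∧
        ∀ z ∈ gridArc e, z.2 = y ∧ (x : ℝ) ≤ z.1 ∧ z.1 ≤ x + 1) := by
    rintro ⟨x, y⟩ ⟨x', y'⟩ h rfl
    rcases h with ⟨h1, h2⟩ | ⟨h1, h2⟩ <;> simp only at h1 h2 <;> subst h1 h2
    · refine Or.inl ⟨_, _, rfl, fun z hz => ?_⟩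
      rw [gridArc_mk] at hz
      simpa [gridPos] using mem_segment_vertical hz (by simp)
    · refine Or.inr ⟨_, _, rfl, fun z hz => ?_⟩
      rw [gridArc_mk] at hz
      simpa [gridPos] using mem_segment_horizontal hz (by simp)
  induction e with
  | h p q =>
    rcases hG p q he with h | h
    · exact key p q h rfl
    · exact key q p h Sym2.eq_swap

lemma IsGridSubgraph.isPlanar {G : SimpleGraph (ℕ × ℤ)} (hG : IsGridSubgraph G) : IsPlanar G := by
  refine ⟨gridPos, gridArc, gridPos_injective, fun v w h => ?_, fun e he v hv => ?_,
    fun e he f hf hne z hz => ?_⟩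
  · rw [gridArc_mk]
    exact isArc_segment (gridPos_injective.ne h.ne)
  · obtain ⟨a, b⟩ := v
    rcases gridArc_cases hG he with ⟨x, y, rfl, h⟩ | ⟨x, y, rfl, h⟩
    · obtain ⟨h1, h2, h3⟩ := h _ hv
      simp only [gridPos] at h1 h2 h3
      norm_cast at h1 h2 h3
      simp only [Sym2.mem_iff, Prod.mk.injEq]
      omega
    · obtain ⟨h1, h2, h3⟩ := h _ hv
      simp only [gridPos] at h1 h2 h3
      norm_cast at h1 h2 h3
      simp only [Sym2.mem_iff, Prod.mk.injEq]
      omega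
  · obtain ⟨z₁, z₂⟩ := z
    obtain ⟨hze, hzf⟩ := hz
    have hv : ∀ (x : ℕ) (y : ℤ), (x, y) ∈ e → (x, y) ∈ f → z₁ = x → z₂ = y →
        ∃ v, v ∈ e ∧ v ∈ f ∧ gridPos v = (z₁, z₂) := by
      rintro x y h1 h2 rfl rfl
      exact ⟨_, h1, h2, rfl⟩
    rcases gridArc_cases hG he with ⟨x, y, rfl, h⟩ | ⟨x, y, rfl, h⟩ <;>
    rcases gridArc_cases hG hf with ⟨x', y', rfl, h'⟩ | ⟨x', y', rfl, h'⟩ <;>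
    obtain ⟨h1, h2, h3⟩ := h _ hze <;> obtain ⟨h1', h2', h3'⟩ := h' _ hzf <;>
    simp only at h1 h2 h3 h1' h2' h3'
    · have hx : x = x' := by exact_mod_cast h1.symm.trans h1'
      subst hx
      have h4 : y ≤ y' + 1 := by exact_mod_cast h2.trans h3'
      have h5 : y' ≤ y + 1 := by exact_mod_cast h2'.trans h3
      have h6 : y ≠ y' := by rintro rfl; exact hne rfl
      rcases (by omega : y = y' + 1 ∨ y' = y + 1) with rfl | rfl
      · refine hv x (y' + 1) (by simp) (by simp) h1 ?_
        push_cast at *; linarith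
      · refine hv x (y + 1) (by simp) (by simp) h1 ?_
        push_cast at *; linarith
    -- Perpendicular unit segments can only meet in the lattice point `(x, y')`, which the
    -- inequalities force to be an end of both.
    · have h4 : x' ≤ x := by rw [h1] at h2'; exact_mod_cast h2'
      have h5 : x ≤ x' + 1 := by rw [h1] at h3'; exact_mod_cast h3'
      have h6 : y ≤ y' := by rw [h1'] at h2; exact_mod_cast h2
      have h7 : y' ≤ y + 1 := by rw [h1'] at h3; exact_mod_cast h3
      refine hv x y' ?_ ?_ h1 h1' <;> simp only [Sym2.mem_iff, Prod.mk.injEq, true_and, and_true] <;> omega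
    · have h4 : x ≤ x' := by rw [h1'] at h2; exact_mod_cast h2
      have h5 : x' ≤ x + 1 := by rw [h1'] at h3; exact_mod_cast h3
      have h6 : y' ≤ y := by rw [h1] at h2'; exact_mod_cast h2'
      have h7 : y ≤ y' + 1 := by rw [h1] at h3'; exact_mod_cast h3'
      refine hv x' y ?_ ?_ h1' h1 <;> simp only [Sym2.mem_iff, Prod.mk.injEq, true_and, and_true] <;> omega
    · have hx : y = y' := by exact_mod_cast h1.symm.trans h1'
      subst hx
      have h4 : x ≤ x' + 1 := by exact_mod_cast h2.trans h3'
      have h5 : x' ≤ x + 1 := by exact_mod_cast h2'.trans h3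
      have h6 : x ≠ x' := by rintro rfl; exact hne rfl
      rcases (by omega : x = x' + 1 ∨ x' = x + 1) with rfl | rfl
      · refine hv (x' + 1) y (by simp) (by simp) ?_ h1
        push_cast at *; linarith
      · refine hv (x + 1) y (by simp) (by simp) ?_ h1
        push_cast at *; linarith

lemma IsGridSubgraph.isLocallyFinite {G : SimpleGraph (ℕ × ℤ)} (hG : IsGridSubgraph G) :
    IsLocallyFinite G := by
  rintro ⟨x, y⟩
  refine ((Set.finite_Icc (x - 1) (x + 1)).prod (Set.finite_Icc (y - 1) (y + 1))).subset ?_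
  rintro ⟨x', y'⟩ h
  simp only [Set.mem_prod, Set.mem_Icc]
  rcases hG _ _ h with (⟨h1, h2⟩ | ⟨h1, h2⟩) | (⟨h1, h2⟩ | ⟨h1, h2⟩) <;>
    simp only at h1 h2 <;> omega

end Grid

/-! ### Finite tree-width from a level function -/

section Ray

/-- The ray with the natural numbers as its vertices. -/
def natRay : SimpleGraph ℕ where
  Adj m n := n = m + 1 ∨ m = n + 1
  symm := ⟨fun _ _ h => h.symm⟩
  loopless := ⟨fun _ h => by omega⟩

lemma natRay_isTree : natRay.IsTree := by
  refine ⟨⟨?_⟩, ?_⟩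
  · have h : ∀ n, natRay.Reachable 0 n := by
      intro n
      induction n with
      | zero => rfl
      | succ n ih =>
        have : natRay.Adj n (n + 1) := Or.inl rfl
        exact ih.trans this.reachable
    exact fun m n => (h m).symm.trans (h n)
  · rw [isAcyclic_iff_forall_adj_isBridge]
    have cross : ∀ k a b (w : natRay.Walk a b), a ≤ k → k < b → s(k, k + 1) ∈ w.edges := by
      intro k a b w
      induction w with
      | nil => intros; omega
      | @cons a a' b h w ih =>
        intro ha hb
        by_cases ha' : a' ≤ k
        · simp [ih ha' hb]
        · have h1 : a = k := by rcases h with h | h <;> omega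
          have h2 : a' = k + 1 := by rcases h with h | h <;> omega
          simp [h1, h2]
    intro v w h
    rw [isBridge_iff_forall_walk_mem_edges]
    intro p
    rcases h with rfl | rfl
    · exact cross v _ _ p le_rfl (Nat.lt_succ_self v)
    · rw [Sym2.eq_swap]
      simpa using cross w _ _ p.reverse le_rfl (Nat.lt_succ_self w)

/-- The tree is a ray, and its bags are the unions of two consecutive levels; two bags with a common
vertex have equal or adjacent indices. -/
lemma hasFiniteTreeWidth_of_levels {V : Type*} {G : SimpleGraph V} (f : V → ℕ)
    (hfin : ∀ n, {v | f v = n}.Finite) (hf : ∀ v w, G.Adj v w → f v ≤ f w + 1) :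
    HasFiniteTreeWidth G := by
  refine ⟨ℕ, natRay, fun n => {v | f v = n} ∪ {v | f v = n + 1},
    ⟨natRay_isTree, fun v => ⟨f v, by simp⟩, fun v w h => ?_, ?_⟩, fun n => (hfin n).union (hfin (n + 1))⟩
  · have h1 := hf v w h
    have h2 := hf w v h.symm
    rcases le_total (f v) (f w) with h3 | h3
    · exact ⟨f v, by simp, by simp; omega⟩
    · exact ⟨f w, by simp; omega, by simp⟩
  · rintro s t p hp r hr v ⟨hs, ht⟩
    simp only [Set.mem_union, Set.mem_ofPred_eq] at hs ht
    have hrst : r = s ∨ r = t := by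
      rcases (by omega : s = t ∨ t = s + 1 ∨ s = t + 1) with rfl | h | h
      · exact Or.inl (by simpa using support_subset_of_isPath natRay_isTree hp .nil hr)
      · have h : natRay.Adj s t := Or.inl h
        simpa using support_subset_of_isPath natRay_isTree hp (.cons h .nil) hr
      · have h : natRay.Adj s t := Or.inr h
        simpa using support_subset_of_isPath natRay_isTree hp (.cons h .nil) hr
    simp only [Set.mem_union, Set.mem_ofPred_eq]
    rcases hrst with rfl | rfl <;> assumption

lemma IsGridSubgraph.hasFiniteTreeWidth {G : SimpleGraph (ℕ × ℤ)} (hG : IsGridSubgraph G) :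
    HasFiniteTreeWidth G := by
  refine hasFiniteTreeWidth_of_levels (fun p => p.1 + p.2.natAbs) (fun n => ?_) ?_
  · refine ((Set.finite_Icc 0 n).prod (Set.finite_Icc (-n : ℤ) n)).subset ?_
    rintro ⟨x, y⟩ h
    simp only [Set.mem_ofPred_eq] at h
    simp only [Set.mem_prod, Set.mem_Icc]
    omega
  · rintro ⟨x, y⟩ ⟨x', y'⟩ h
    simp only
    rcases hG _ _ h with (⟨h1, h2⟩ | ⟨h1, h2⟩) | (⟨h1, h2⟩ | ⟨h1, h2⟩) <;>
      simp only at h1 h2 <;> omega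

end Ray

/-! ### The strip graph and its basic links -/

section Strips

/-- The columns along which the strips in the lower half-plane are attached to the upper
half-plane. -/
def Contact (x : ℕ) : Prop := ∃ j : ℕ, 9 * 2 ^ j ≤ x ∧ x < 10 * 2 ^ j

/-- `q` is the upper or right neighbour of `p`, and the edge between them is kept. -/
def StripStep (p q : ℕ × ℤ) : Prop :=
  (q.1 = p.1 ∧ q.2 = p.2 + 1 ∧ (p.2 = -1 → Contact p.1)) ∨
    (q.1 = p.1 + 1 ∧ q.2 = p.2 ∧ ∀ j : ℕ, p.1 + 1 = 14 * 2 ^ j → -(2 * 2 ^ j : ℤ) ≤ p.2)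

/-- A subgraph of the half-plane grid: its lower quadrant is divided into the strips
`7 * 2 ^ j ≤ x < 14 * 2 ^ j`, where the `j`-th strip is joined to the next one by `2 * 2 ^ j` edges,
and to the upper quadrant by `2 ^ j` edges. -/
def stripGraph : SimpleGraph (ℕ × ℤ) where
  Adj p q := StripStep p q ∨ StripStep q p
  symm := ⟨fun _ _ h => h.symm⟩
  loopless := ⟨fun p h => by
    rcases h with (⟨_, h, _⟩ | ⟨h, _⟩) | (⟨_, h, _⟩ | ⟨h, _⟩) <;> omega⟩

lemma StripStep.gridStep {p q : ℕ × ℤ} (h : StripStep p q) : GridStep p q := by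
  rcases h with ⟨h, h', _⟩ | ⟨h, h', _⟩
  exacts [Or.inl ⟨h, h'⟩, Or.inr ⟨h, h'⟩]

lemma stripGraph_isGridSubgraph : IsGridSubgraph stripGraph := fun _ _ h =>
  h.imp StripStep.gridStep StripStep.gridStep

variable {X : Set (ℕ × ℤ)}

lemma linked_vertical_of_le {x : ℕ} {y y' : ℤ} (hy : y ≤ y')
    (hc : y' < 0 ∨ 0 ≤ y ∨ Contact x) (hX : ∀ z, y ≤ z → z ≤ y' → (x, z) ∉ X) :
    Linked stripGraph X (x, y) (x, y') := by
  induction y', hy using Int.leInduction with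
  | base => exact Linked.refl (hX y le_rfl le_rfl)
  | succ n hn ih =>
    refine (ih (hc.imp_left fun h => by omega) fun z h1 h2 => hX z h1 (by omega)).trans
      (Linked.of_adj (Or.inl (Or.inl ⟨rfl, rfl, fun h => ?_⟩)) (hX n hn (by omega))
        (hX (n + 1) (by omega) le_rfl))
    simp only at h
    rcases hc with h' | h' | h'
    · omega
    · omega
    · exact h'

lemma linked_horizontal_of_le {x x' : ℕ} {y : ℤ} (hx : x ≤ x')
    (hw : ∀ z, x ≤ z → z < x' → ∀ j : ℕ, z + 1 = 14 * 2 ^ j → -(2 * 2 ^ j : ℤ) ≤ y)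
    (hX : ∀ z, x ≤ z → z ≤ x' → (z, y) ∉ X) : Linked stripGraph X (x, y) (x', y) := by
  induction x', hx using Nat.le_induction with
  | base => exact Linked.refl (hX x le_rfl le_rfl)
  | succ n hn ih =>
    exact (ih (fun z h1 h2 => hw z h1 (by omega)) fun z h1 h2 => hX z h1 (by omega)).trans
      (Linked.of_adj (Or.inl (Or.inr ⟨rfl, rfl, hw n hn (by omega)⟩)) (hX n hn (by omega))
        (hX (n + 1) (by omega) le_rfl))

lemma linked_vertical {x : ℕ} {y y' : ℤ} (hc : (y < 0 ∧ y' < 0) ∨ (0 ≤ y ∧ 0 ≤ y') ∨ Contact x)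
    (hX : ∀ z, min y y' ≤ z → z ≤ max y y' → (x, z) ∉ X) :
    Linked stripGraph X (x, y) (x, y') := by
  rcases le_total y y' with h | h
  · rw [min_eq_left h, max_eq_right h] at hX
    exact linked_vertical_of_le h (by tauto) hX
  · rw [min_eq_right h, max_eq_left h] at hX
    exact (linked_vertical_of_le h (by tauto) hX).symm

/-- Compares two powers linearly, so that `omega` can order walls and contacts of different strips.
-/
lemma two_pow_cases (j l : ℕ) : 2 * 2 ^ l ≤ 2 ^ j ∨ l = j ∨ 2 * 2 ^ j ≤ 2 ^ l := by
  rcases lt_trichotomy l j with h | h | h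
  · left
    rw [← pow_succ']
    exact Nat.pow_le_pow_right (by norm_num) h
  · exact Or.inr (Or.inl h)
  · right; right
    rw [← pow_succ']
    exact Nat.pow_le_pow_right (by norm_num) h

lemma linked_strip {j x x' : ℕ} {y : ℤ} (hx : 7 * 2 ^ j ≤ x ∧ x < 14 * 2 ^ j)
    (hx' : 7 * 2 ^ j ≤ x' ∧ x' < 14 * 2 ^ j)
    (hX : ∀ z, 7 * 2 ^ j ≤ z → z < 14 * 2 ^ j → (z, y) ∉ X) :
    Linked stripGraph X (x, y) (x', y) := by
  have key : ∀ x x', 7 * 2 ^ j ≤ x → x' < 14 * 2 ^ j → x ≤ x' →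
      Linked stripGraph X (x, y) (x', y) := fun x x' h1 h2 h =>
    linked_horizontal_of_le h (fun z h3 h4 l hl => by
        rcases two_pow_cases j l with h5 | rfl | h5 <;> omega)
      fun z h3 h4 => hX z (by omega) (by omega)
  rcases le_total x x' with h | h
  · exact key x x' hx.1 hx'.2 h
  · exact (key x' x hx'.1 hx.2 h).symm

/-- The only wall in this range of columns is at `14 * 2 ^ j`, and row `y` passes through its door.
-/
lemma linked_door {j x x' : ℕ} {y : ℤ} (hy : -(2 * 2 ^ j : ℤ) ≤ y) (hx : 10 * 2 ^ j ≤ x)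
    (hx' : x' < 18 * 2 ^ j) (h : x ≤ x')
    (hX : ∀ z, 10 * 2 ^ j ≤ z → z < 18 * 2 ^ j → (z, y) ∉ X) :
    Linked stripGraph X (x, y) (x', y) :=
  linked_horizontal_of_le h (fun z h3 h4 l hl => by
      rcases two_pow_cases j l with h5 | rfl | h5
      · omega
      · exact hy
      · omega)
    fun z h3 h4 => hX z (by omega) (by omega)

lemma linked_upper {x x' : ℕ} {y : ℤ} (hy : 0 ≤ y) (hX : ∀ z, (z, y) ∉ X) :
    Linked stripGraph X (x, y) (x', y) := by
  have hw : ∀ z j : ℕ, z + 1 = 14 * 2 ^ j → -(2 * 2 ^ j : ℤ) ≤ y := fun z j _ => by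
    have : (0 : ℤ) < 2 ^ j := by positivity
    omega
  rcases le_total x x' with h | h
  · exact linked_horizontal_of_le h (fun z _ _ => hw z) fun z _ _ => hX z
  · exact (linked_horizontal_of_le h (fun z _ _ => hw z) fun z _ _ => hX z).symm

lemma stripGraph_connected : stripGraph.Connected := by
  have h0 : ∀ x y, Linked stripGraph ∅ (x, y) (9, 0) := by
    intro x y
    have hup : ∀ x y, 0 ≤ y → Linked stripGraph ∅ (x, y) (9, 0) := fun x y hy =>
      (linked_upper hy (by simp)).trans (linked_vertical (by omega) (by simp))
    rcases lt_or_ge y 0 with hy | hy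
    -- Row `-1` passes through every door, so it leads right from column `x` to the contact column
    -- `9 * 2 ^ x`.
    · refine (linked_vertical (y' := -1) (by omega) (by simp)).trans
        (Linked.trans ?_ ((linked_vertical (y := -1) (Or.inr (Or.inr ⟨x, ?_⟩)) (by simp)).trans
          (hup (9 * 2 ^ x) 0 le_rfl)))
      · refine linked_horizontal_of_le ?_ (fun z _ _ j _ => ?_) (by simp)
        · have := Nat.lt_two_pow_self (n := x)
          omega
        · have : (0 : ℤ) < 2 ^ j := by positivity
          omega
      · have : 0 < 2 ^ x := by positivity
        omega
    · exact hup x y hy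
  rw [connected_iff]
  refine ⟨fun p q => ?_, ⟨(0, 0)⟩⟩
  obtain ⟨w, -⟩ := (h0 p.1 p.2).trans (h0 q.1 q.2).symm
  exact ⟨w⟩

end Strips

/-! ### The small separator behind door `i` and the first contacts -/

section Separator

/-- A set of `4 * 2 ^ i - 1` vertices separating the first `i + 1` strips from the rest. -/
noncomputable def stripSeparator (i : ℕ) : Finset (ℕ × ℤ) :=
  (Finset.Ico (-(2 * 2 ^ i : ℤ)) 0).image (fun y => (14 * 2 ^ i - 1, y)) ∪
    (Finset.range (i + 1)).biUnion
      fun j => (Finset.Ico (9 * 2 ^ j) (10 * 2 ^ j)).image fun x => (x, -1)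

lemma card_stripSeparator_lt (i : ℕ) : (stripSeparator i).card < 4 * 2 ^ i := by
  have h1 : ((Finset.Ico (-(2 * 2 ^ i : ℤ)) 0).image
      (fun y => ((14 * 2 ^ i - 1, y) : ℕ × ℤ))).card ≤ 2 * 2 ^ i := by
    refine Finset.card_image_le.trans ?_
    simp only [Int.card_Ico]
    have : ((2 ^ i : ℕ) : ℤ) = 2 ^ i := by push_cast; rfl
    omega
  have h2 : ∀ n : ℕ, ((Finset.range n).biUnion fun j =>
      (Finset.Ico (9 * 2 ^ j) (10 * 2 ^ j)).image fun x => ((x, -1) : ℕ × ℤ)).card < 2 ^ n := by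
    intro n
    induction n with
    | zero => simp
    | succ n ih =>
      rw [Finset.range_add_one, Finset.biUnion_insert, pow_succ]
      have h3 : ((Finset.Ico (9 * 2 ^ n) (10 * 2 ^ n)).image
          fun x => ((x, -1) : ℕ × ℤ)).card ≤ 2 ^ n := by
        refine Finset.card_image_le.trans ?_
        simp only [Nat.card_Ico]
        omega
      exact (Finset.card_union_le _ _).trans_lt (by omega)
  have h3 := h2 (i + 1)
  rw [pow_succ] at h3
  exact (Finset.card_union_le _ _).trans_lt (by omega)

/-- The region can be left only upwards through a contact or rightwards through door `i`, and the
vertex from which the walk first leaves is in the separator. -/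
lemma exists_mem_stripSeparator (i : ℕ) {a b : ℕ × ℤ} (w : stripGraph.Walk a b)
    (ha : a.2 < 0 ∧ a.1 < 14 * 2 ^ i) (hb : ¬ (b.2 < 0 ∧ b.1 < 14 * 2 ^ i)) :
    ∃ v ∈ w.support, v ∈ stripSeparator i := by
  induction w with
  | nil => exact absurd ha hb
  | @cons p q b h w ih =>
    by_cases hq : q.2 < 0 ∧ q.1 < 14 * 2 ^ i
    · obtain ⟨v, hv, hvS⟩ := ih hq hb
      exact ⟨v, by simp [hv], hvS⟩
    refine ⟨p, by simp, ?_⟩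
    obtain ⟨x, y⟩ := p
    obtain ⟨x', y'⟩ := q
    simp only [stripSeparator, Finset.mem_union, Finset.mem_image, Finset.mem_Ico,
      Finset.mem_biUnion, Finset.mem_range, Prod.mk.injEq]
    rcases h with (⟨h1, h2, h3⟩ | ⟨h1, h2, h3⟩) | (⟨h1, h2, h3⟩ | ⟨h1, h2, h3⟩) <;>
      simp only at h1 h2 h3 ha hq
    · right
      obtain ⟨j, hj⟩ := h3 (by omega)
      refine ⟨j, ?_, x, hj, rfl, by omega⟩
      -- The contacts of a later strip start at column `18 * 2 ^ i` or beyond, outside the region.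
      by_contra hij
      have h4 : 2 ^ i ≤ 2 ^ j := Nat.pow_le_pow_right (by norm_num) (by omega)
      rcases two_pow_cases i j with h5 | rfl | h5 <;> omega
    · left
      have := h3 i (by omega)
      exact ⟨y, by omega, by omega, rfl⟩
    · omega
    · omega

end Separator

/-! ### Links that survive the deletion of few vertices -/

section Cut

/-- Counting: a set of fewer than `Y.card` vertices misses some fibre of `f` over `Y`. -/
lemma exists_forall_ne_of_card_lt {α β : Type*} [DecidableEq β] {X : Finset α} {Y : Finset β}
    (h : X.card < Y.card) (f : α → β) : ∃ b ∈ Y, ∀ p ∈ X, f p ≠ b := by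
  have : ¬ Y ⊆ X.image f := fun hs =>
    absurd (Finset.card_le_card hs) (not_le.2 (Finset.card_image_le.trans_lt h))
  obtain ⟨b, hb, hb'⟩ := Finset.not_subset.1 this
  exact ⟨b, hb, fun p hp hpb => hb' (Finset.mem_image.2 ⟨p, hp, hpb⟩)⟩

variable {X : Finset (ℕ × ℤ)}

lemma exists_free_column (P : ℕ × ℤ → Prop) [DecidablePred P] {m n : ℕ}
    (h : (X.filter P).card < n - m) : ∃ x, m ≤ x ∧ x < n ∧ ∀ y, P (x, y) → (x, y) ∉ X := by
  obtain ⟨x, hx, hx'⟩ := exists_forall_ne_of_card_lt (Y := Finset.Ico m n) (by simpa using h)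
    Prod.fst
  rw [Finset.mem_Ico] at hx
  exact ⟨x, hx.1, hx.2, fun y hy hm => hx' _ (Finset.mem_filter.2 ⟨hm, hy⟩) rfl⟩

lemma exists_free_row (P : ℕ × ℤ → Prop) [DecidablePred P] {n : ℕ}
    (h : (X.filter P).card < n) :
    ∃ y : ℤ, -(n : ℤ) ≤ y ∧ y < 0 ∧ ∀ x, P (x, y) → (x, y) ∉ X := by
  obtain ⟨y, hy, hy'⟩ := exists_forall_ne_of_card_lt (Y := Finset.Ico (-(n : ℤ)) 0)
    (by simpa using h) Prod.snd
  rw [Finset.mem_Ico] at hy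
  exact ⟨y, hy.1, hy.2, fun x hx hm => hy' _ (Finset.mem_filter.2 ⟨hm, hx⟩) rfl⟩

/-- All vertices of `X` have height between `-D` and `D`. -/
def HeightLt (X : Finset (ℕ × ℤ)) (D : ℕ) : Prop :=
  0 < D ∧ ∀ p ∈ X, -(D : ℤ) < p.2 ∧ p.2 < D

lemma exists_heightLt (X : Finset (ℕ × ℤ)) : ∃ D, HeightLt X D := by
  refine ⟨X.sup (fun p => p.2.natAbs) + 1, by omega, fun p hp => ?_⟩
  have : p.2.natAbs ≤ X.sup fun p => p.2.natAbs :=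
    Finset.le_sup (f := fun p : ℕ × ℤ => p.2.natAbs) hp
  omega

/-- `a` is linked, avoiding `X`, to the vertex of depth `D` at the left side of the `j`-th strip. -/
def LinkedDeep (X : Finset (ℕ × ℤ)) (D j : ℕ) (a : ℕ × ℤ) : Prop :=
  Linked stripGraph (X : Set (ℕ × ℤ)) a (7 * 2 ^ j, -(D : ℤ))

variable {D : ℕ}

/-- Row `-D` lies below all of `X`, so any free column of the strip leads down to it and then along
it. -/
lemma HeightLt.linkedDeep_of_column (hD : HeightLt X D) {j x : ℕ} {y : ℤ}
    (hx : 7 * 2 ^ j ≤ x ∧ x < 14 * 2 ^ j) (hy : y < 0) (hX : ∀ z < 0, (x, z) ∉ X) :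
    LinkedDeep X D j (x, y) := by
  have h0 := hD.1
  refine (linked_vertical (y' := -(D : ℤ)) (by omega) fun z _ h => ?_).trans
    (linked_strip hx (by omega) fun z _ _ h => ?_)
  · exact hX z (by omega)
  · have := hD.2 _ h
    simp only at this
    omega

lemma HeightLt.linked_top (hD : HeightLt X D) {x : ℕ} {y : ℤ} (hc : 0 ≤ y ∨ Contact x)
    (hX : ∀ z, y ≤ z → (x, z) ∉ X) (hyD : y ≤ D) :
    Linked stripGraph (X : Set (ℕ × ℤ)) (x, y) (7, (D : ℤ)) := by
  have h0 := hD.1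
  refine (linked_vertical_of_le hyD (by tauto) fun z h _ => hX z h).trans
    (linked_upper (by omega) fun z h => ?_)
  have := hD.2 _ h
  simp only at this
  omega

lemma HeightLt.linkedDeep_top (hD : HeightLt X D) {j : ℕ}
    (h : (X.filter fun p => 9 * 2 ^ j ≤ p.1 ∧ p.1 < 10 * 2 ^ j).card < 2 ^ j) :
    LinkedDeep X D j (7, (D : ℤ)) := by
  have h0 := hD.1
  obtain ⟨x, hx, hx', hX⟩ := exists_free_column _ (m := 9 * 2 ^ j) (n := 10 * 2 ^ j)
    (h.trans_le (by omega))
  have h1 := hD.linkedDeep_of_column (j := j) (y := -1) (x := x) (by omega) (by omega)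
    fun z _ => hX z ⟨hx, hx'⟩
  exact (hD.linked_top (y := -1) (Or.inr ⟨j, hx, hx'⟩) (fun z _ => hX z ⟨hx, hx'⟩)
    (by omega)).symm.trans h1

/-- `X` misses some row of the door and a column on each side of it; together these join the deep
parts of both strips. The columns used avoid all contacts, so that doors and contacts are charged to
disjoint parts of `X`. -/
lemma HeightLt.linkedDeep_succ (hD : HeightLt X D) {j : ℕ}
    (hdoor : (X.filter fun p => 10 * 2 ^ j ≤ p.1 ∧ p.1 < 18 * 2 ^ j).card < 2 * 2 ^ j) :
    LinkedDeep X D j (7 * 2 ^ (j + 1), -(D : ℤ)) := by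
  obtain ⟨y, hy, hy', hyX⟩ := exists_free_row _ hdoor
  obtain ⟨x, hx, hx', hxX⟩ := exists_free_column _ (m := 10 * 2 ^ j) (n := 14 * 2 ^ j)
    (hdoor.trans_le (by omega))
  obtain ⟨z, hz, hz', hzX⟩ := exists_free_column _ (m := 14 * 2 ^ j) (n := 18 * 2 ^ j)
    (hdoor.trans_le (by omega))
  have h1 := hD.linkedDeep_of_column (j := j) (x := x) (by omega) hy'
    fun s _ => hxX s (by simp only; omega)
  have h2 := hD.linkedDeep_of_column (j := j + 1) (x := z) (by omega) hy'
    fun s _ => hzX s (by simp only; omega)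
  have h3 : Linked stripGraph (X : Set (ℕ × ℤ)) (x, y) (z, y) :=
    linked_door (j := j) (by exact_mod_cast hy) hx hz' (by omega) fun s h h' => hyX s ⟨h, h'⟩
  exact (h2.symm.trans h3.symm).trans h1

end Cut

/-! ### How a small cut must distribute its vertices -/

section SmallCut

variable {X : Finset (ℕ × ℤ)} {D : ℕ}

lemma card_filter_add_le {P Q R : ℕ × ℤ → Prop} [DecidablePred P] [DecidablePred Q]
    [DecidablePred R] (hPR : ∀ p, P p → R p) (hQR : ∀ p, Q p → R p) (hPQ : ∀ p, P p → ¬ Q p) :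
    (X.filter P).card + (X.filter Q).card ≤ (X.filter R).card := by
  rw [← Finset.card_union_of_disjoint]
  · refine Finset.card_le_card fun p hp => ?_
    simp only [Finset.mem_union, Finset.mem_filter] at hp ⊢
    rcases hp with ⟨h, h'⟩ | ⟨h, h'⟩
    exacts [⟨h, hPR p h'⟩, ⟨h, hQR p h'⟩]
  · rw [Finset.disjoint_filter]
    exact fun p _ => hPQ p

lemma card_filter_mono {P Q : ℕ × ℤ → Prop} [DecidablePred P] [DecidablePred Q]
    (hPQ : ∀ p, P p → Q p) : (X.filter P).card ≤ (X.filter Q).card :=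
  Finset.card_le_card fun p hp => by
    simp only [Finset.mem_filter] at hp ⊢
    exact ⟨hp.1, hPQ p hp.2⟩

/-- Downward induction on `j = i - m`. Fewer than `4 * 2 ^ j` vertices lie left of `10 * 2 ^ (j +
1)`, and blocking the contacts of strip `j + 1` costs `2 * 2 ^ j` of them. Fewer than `2 * 2 ^ j`
remain left of column `18 * 2 ^ j`, so door `j` stays open. -/
lemma HeightLt.linkedDeep_of_cut_aux (hD : HeightLt X D) {i : ℕ} (hX : X.card < 4 * 2 ^ i)
    (h10 : (X.filter fun p => p.1 < 10 * 2 ^ i).card < 2 * 2 ^ i)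
    (htop : ¬ LinkedDeep X D i (7, (D : ℤ))) (m : ℕ) :
    ∀ j, j + m = i → (X.filter fun p => p.1 < 10 * 2 ^ j).card < 2 * 2 ^ j ∧
      (X.filter fun p => p.1 < 14 * 2 ^ j).card < 4 * 2 ^ j ∧
      LinkedDeep X D i (7 * 2 ^ j, -(D : ℤ)) := by
  induction m with
  | zero =>
    rintro j rfl
    refine ⟨h10, (Finset.card_filter_le _ _).trans_lt hX, Linked.refl fun h => ?_⟩
    have := hD.2 _ h
    simp only at this
    omega
  | succ m ih =>
    intro j hj
    obtain ⟨h1, -, h3⟩ := ih (j + 1) (by omega)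
    have hC : ¬ (X.filter fun p => 9 * 2 ^ (j + 1) ≤ p.1 ∧ p.1 < 10 * 2 ^ (j + 1)).card
        < 2 ^ (j + 1) := fun h => htop ((hD.linkedDeep_top h).trans h3)
    have h4 := card_filter_add_le (X := X) (P := fun p => p.1 < 18 * 2 ^ j)
      (Q := fun p => 9 * 2 ^ (j + 1) ≤ p.1 ∧ p.1 < 10 * 2 ^ (j + 1))
      (R := fun p => p.1 < 10 * 2 ^ (j + 1)) (fun p h => by omega) (fun p h => by omega)
      (fun p h => by omega)
    have h5 : (X.filter fun p => p.1 < 18 * 2 ^ j).card < 2 * 2 ^ j := by omega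
    refine ⟨(card_filter_mono fun p h => ?_).trans_lt h5,
      (card_filter_mono fun p h => ?_).trans_lt (h5.trans_le ?_), ?_⟩
    · omega
    · omega
    · omega
    · have h6 : LinkedDeep X D j (7 * 2 ^ (j + 1), -(D : ℤ)) :=
        hD.linkedDeep_succ ((card_filter_mono fun p h => by omega).trans_lt h5)
      exact h6.symm.trans h3

/-- A set of fewer than `4 * 2 ^ i` vertices that separates the `i`-th strip from the next one
leaves the first `i + 1` strips and `(7, -1)` on one side, and `(7, 0)` on the other. -/
lemma HeightLt.linkedDeep_of_cut (hD : HeightLt X D) {i : ℕ} (hX : X.card < 4 * 2 ^ i)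
    (hcut : ¬ LinkedDeep X D i (7 * 2 ^ (i + 1), -(D : ℤ))) :
    LinkedDeep X D (i + 1) (7, 0) ∧ ∀ j ≤ i, LinkedDeep X D j (7, -1) ∧
      (X.filter fun p => p.1 < 14 * 2 ^ j).card < 4 * 2 ^ j := by
  -- Blocking door `i` takes at least half of the budget; what remains can neither block the `2 ^ (i
  -- + 1)` contacts of the next strip nor reach `2 * 2 ^ i` vertices further left.
  have hdoor : ¬ (X.filter fun p => 10 * 2 ^ i ≤ p.1 ∧ p.1 < 18 * 2 ^ i).card < 2 * 2 ^ i :=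
    fun h => hcut (hD.linkedDeep_succ h)
  have htop' : LinkedDeep X D (i + 1) (7, (D : ℤ)) := by
    refine hD.linkedDeep_top ?_
    have h := card_filter_add_le (X := X) (P := fun p => 10 * 2 ^ i ≤ p.1 ∧ p.1 < 18 * 2 ^ i)
      (Q := fun p => 9 * 2 ^ (i + 1) ≤ p.1 ∧ p.1 < 10 * 2 ^ (i + 1))
      (R := fun _ => True) (fun p h => trivial) (fun p h => trivial) (fun p h => by omega)
    rw [Finset.filter_true] at h
    omega
  have htop : ¬ LinkedDeep X D i (7, (D : ℤ)) := fun h => hcut (htop'.symm.trans h)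
  have h10 : (X.filter fun p => p.1 < 10 * 2 ^ i).card < 2 * 2 ^ i := by
    have h := card_filter_add_le (X := X) (P := fun p => 10 * 2 ^ i ≤ p.1 ∧ p.1 < 18 * 2 ^ i)
      (Q := fun p => p.1 < 10 * 2 ^ i)
      (R := fun _ => True) (fun p h => trivial) (fun p h => trivial) (fun p h => by omega)
    rw [Finset.filter_true] at h
    omega
  have haux := hD.linkedDeep_of_cut_aux hX h10 htop
  obtain ⟨h1, -, h3⟩ := haux i 0 (by omega)
  -- At most one vertex of `X` lies left of column `10`, and it is used up by column `9`, the only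
  -- contact of strip `0`. So column `7` is free.
  have hC : ¬ (X.filter fun p => 9 * 2 ^ 0 ≤ p.1 ∧ p.1 < 10 * 2 ^ 0).card < 2 ^ 0 :=
    fun h => htop ((hD.linkedDeep_top h).trans h3)
  have h9 : (X.filter fun p => p.1 < 9).card = 0 := by
    have h := card_filter_add_le (X := X) (P := fun p => p.1 < 9)
      (Q := fun p => 9 * 2 ^ 0 ≤ p.1 ∧ p.1 < 10 * 2 ^ 0) (R := fun p => p.1 < 10 * 2 ^ 0)
      (fun p h => by omega) (fun p h => by omega) (fun p h => by omega)
    omega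
  have hfree : ∀ z : ℤ, (7, z) ∉ X := fun z hz => by
    rw [Finset.card_eq_zero, Finset.filter_eq_empty_iff] at h9
    exact h9 hz (by norm_num)
  have hu : LinkedDeep X D i (7, -1) :=
    (hD.linkedDeep_of_column (j := 0) (by norm_num) (by norm_num) fun z _ => hfree z).trans h3
  refine ⟨(hD.linked_top (Or.inl le_rfl) (fun z _ => hfree z) (by positivity)).trans htop',
    fun j hj => ?_⟩
  obtain ⟨-, h4, h5⟩ := haux (i - j) j (by omega)
  exact ⟨hu.trans h5.symm, h4⟩

end SmallCut

/-! ### Bags capturing a square of a strip -/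

section Capture

/-- `B` meets all columns or all rows of a square in the `j`-th strip. -/
def MeetsSquare (B : Set (ℕ × ℤ)) (j : ℕ) : Prop :=
  (∀ x, 7 * 2 ^ j ≤ x → x < 14 * 2 ^ j → ∃ y, -(7 * 2 ^ j : ℤ) ≤ y ∧ y < 0 ∧ (x, y) ∈ B) ∨
    ∀ y, -(7 * 2 ^ j : ℤ) ≤ y → y < 0 → ∃ x, 7 * 2 ^ j ≤ x ∧ x < 14 * 2 ^ j ∧ (x, y) ∈ B

/-- The union of a row and a column of a square in the `j`-th strip. -/
def cross (j : ℕ) (p : ℕ × ℤ) : Set (ℕ × ℤ) :=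
  {v | (v.1 = p.1 ∨ v.2 = p.2) ∧ 7 * 2 ^ j ≤ v.1 ∧ v.1 < 14 * 2 ^ j ∧
    -(7 * 2 ^ j : ℤ) ≤ v.2 ∧ v.2 < 0}

lemma linked_cross {j : ℕ} {p a b : ℕ × ℤ} (hp : p ∈ cross j p) (ha : a ∈ cross j p)
    (hb : b ∈ cross j p) : Linked stripGraph (cross j p)ᶜ a b := by
  have key : ∀ a ∈ cross j p, Linked stripGraph (cross j p)ᶜ a p := by
    rintro ⟨x, y⟩ ha
    obtain ⟨x', y'⟩ := p
    obtain ⟨-, hp⟩ := hp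
    obtain ⟨h | h, ha⟩ := ha <;> simp only at h hp ha <;> subst h
    · refine linked_vertical (by omega) fun z h1 h2 => ?_
      refine not_not.2 ⟨Or.inl rfl, ?_⟩
      simp only
      omega
    · refine linked_strip (j := j) (by omega) (by omega) fun z h1 h2 => ?_
      refine not_not.2 ⟨Or.inr rfl, ?_⟩
      simp only
      omega
  exact (key a ha).trans (key b hb).symm

variable {N : Type*} {T : SimpleGraph N} {bag : N → Set (ℕ × ℤ)}

/-- The crosses in a square are connected and meet pairwise, so one bag meets them all. A bag
missing both a row and a column would miss their cross. -/
lemma IsTreeDecomposition.exists_meetsSquare (h : IsTreeDecomposition stripGraph T bag) (j : ℕ) :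
    ∃ t, MeetsSquare (bag t) j := by
  let F : Finset (ℕ × ℤ) :=
    Finset.Ico (7 * 2 ^ j) (14 * 2 ^ j) ×ˢ Finset.Ico (-(7 * 2 ^ j : ℤ)) 0
  have hF : ∀ p, p ∈ F ↔
      (7 * 2 ^ j ≤ p.1 ∧ p.1 < 14 * 2 ^ j) ∧ -(7 * 2 ^ j : ℤ) ≤ p.2 ∧ p.2 < 0 := fun p => by
    simp [F, Finset.mem_product]
  obtain ⟨t, ht⟩ := h.exists_bag_cover F (cross j)
    (fun p hp a ha b hb => linked_cross
      ⟨Or.inl rfl, ((hF p).1 hp).1.1, ((hF p).1 hp).1.2, ((hF p).1 hp).2⟩ ha hb)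
    (fun p hp q hq => ⟨(p.1, q.2), ⟨Or.inl rfl, ((hF p).1 hp).1.1, ((hF p).1 hp).1.2,
      ((hF q).1 hq).2⟩, Or.inr rfl, ((hF p).1 hp).1.1, ((hF p).1 hp).1.2, ((hF q).1 hq).2⟩)
  refine ⟨t, ?_⟩
  by_contra hn
  simp only [MeetsSquare] at hn
  push Not at hn
  obtain ⟨⟨x, hx, hx', hxB⟩, y, hy, hy', hyB⟩ := hn
  obtain ⟨⟨x', y'⟩, hB, h1 | h1, h2⟩ := ht (x, y) ((hF _).2 ⟨⟨hx, hx'⟩, hy, hy'⟩) <;>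
    simp only at h1 h2 <;> subst h1
  · exact hxB y' h2.2.2.1 h2.2.2.2 hB
  · exact hyB x' h2.1 h2.2.1 hB

/-- `X` is too small to hit every column or every row of the square. If `B` meets all columns, a
free column suffices; if it meets all rows, a free row leads from `B` to a free column. -/
lemma MeetsSquare.exists_linkedDeep {B : Set (ℕ × ℤ)} {j : ℕ} (hB : MeetsSquare B j)
    {X : Finset (ℕ × ℤ)} {D : ℕ} (hD : HeightLt X D)
    (hX : (X.filter fun p => p.1 < 14 * 2 ^ j).card < 7 * 2 ^ j) :
    ∃ b ∈ B, LinkedDeep X D j b := by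
  obtain hB | hB := hB
  · obtain ⟨x, hx, hx', hxX⟩ := exists_free_column _ (m := 7 * 2 ^ j) (n := 14 * 2 ^ j)
      (hX.trans_le (by omega))
    obtain ⟨y, -, hy, hyB⟩ := hB x hx hx'
    exact ⟨_, hyB, hD.linkedDeep_of_column ⟨hx, hx'⟩ hy fun z _ => hxX z hx'⟩
  · obtain ⟨x, hx, hx', hxX⟩ := exists_free_column _ (m := 7 * 2 ^ j) (n := 14 * 2 ^ j)
      (hX.trans_le (by omega))
    obtain ⟨y, hy, hy', hyX⟩ := exists_free_row _ hX
    obtain ⟨x', h1, h2, hB⟩ := hB y (by exact_mod_cast hy) hy'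
    exact ⟨_, hB, (linked_strip ⟨h1, h2⟩ ⟨hx, hx'⟩ fun z _ h => hyX z h).trans
      (hD.linkedDeep_of_column ⟨hx, hx'⟩ hy' fun z _ => hxX z hx')⟩

lemma MeetsSquare.exists_finset {B : Set (ℕ × ℤ)} {j n : ℕ} (hB : MeetsSquare B j)
    (hn : n ≤ 7 * 2 ^ j) : ∃ Z : Finset (ℕ × ℤ), (Z : Set (ℕ × ℤ)) ⊆ B ∧ Z.card = n ∧
      ∀ p ∈ Z, p.2 < 0 ∧ 7 * 2 ^ j ≤ p.1 ∧ p.1 < 14 * 2 ^ j := by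
  suffices h : ∃ Z : Finset (ℕ × ℤ), (Z : Set (ℕ × ℤ)) ⊆ B ∧ 7 * 2 ^ j ≤ Z.card ∧
      ∀ p ∈ Z, p.2 < 0 ∧ 7 * 2 ^ j ≤ p.1 ∧ p.1 < 14 * 2 ^ j by
    obtain ⟨Z, hZB, hZ, hZp⟩ := h
    obtain ⟨Z', hZ', hcard⟩ := Finset.exists_subset_card_eq (hn.trans hZ)
    exact ⟨Z', fun p hp => hZB (hZ' hp), hcard, fun p hp => hZp p (hZ' hp)⟩
  obtain hB | hB := hB
  · choose! f hf using hB
    refine ⟨(Finset.Ico (7 * 2 ^ j) (14 * 2 ^ j)).image fun x => (x, f x), ?_, ?_, ?_⟩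
    · intro p hp
      obtain ⟨x, hx, rfl⟩ := Finset.mem_image.1 hp
      rw [Finset.mem_Ico] at hx
      exact (hf x hx.1 hx.2).2.2
    · rw [Finset.card_image_of_injective _ fun x x' h => (Prod.ext_iff.1 h).1, Nat.card_Ico]
      omega
    · intro p hp
      obtain ⟨x, hx, rfl⟩ := Finset.mem_image.1 hp
      rw [Finset.mem_Ico] at hx
      exact ⟨(hf x hx.1 hx.2).2.1, hx⟩
  · choose! f hf using hB
    refine ⟨(Finset.Ico (-(7 * 2 ^ j : ℤ)) 0).image fun y => (f y, y), ?_, ?_, ?_⟩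
    · intro p hp
      obtain ⟨y, hy, rfl⟩ := Finset.mem_image.1 hp
      rw [Finset.mem_Ico] at hy
      exact (hf y hy.1 hy.2).2.2
    · rw [Finset.card_image_of_injective _ fun x x' h => (Prod.ext_iff.1 h).2, Int.card_Ico]
      have : ((2 ^ j : ℕ) : ℤ) = 2 ^ j := by push_cast; rfl
      omega
    · intro p hp
      obtain ⟨y, hy, rfl⟩ := Finset.mem_image.1 hp
      rw [Finset.mem_Ico] at hy
      exact ⟨hy.2, (hf y hy.1 hy.2).1, (hf y hy.1 hy.2).2.1⟩

end Capture

/-! ### The contradiction -/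

section Main

variable {N : Type*} {T : SimpleGraph N} {bag : N → Set (ℕ × ℤ)}

/-- Leanness is applied to `4 * 2 ^ i` vertices in each bag; `stripSeparator i` rules out the
disjoint paths. -/
lemma IsLean.exists_dart (hl : IsLean stripGraph T bag) {i : ℕ} {s t : N}
    (hs : MeetsSquare (bag s) i) (ht : MeetsSquare (bag t) (i + 1)) :
    ∃ p : T.Walk s t, p.IsPath ∧ ∃ d ∈ p.darts,
      (bag d.fst ∩ bag d.snd).encard < ((4 * 2 ^ i : ℕ) : ℕ∞) := by
  obtain ⟨Zs, hZs, hcs, hps⟩ := hs.exists_finset (n := 4 * 2 ^ i) (by omega)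
  obtain ⟨Zt, hZt, hct, hpt⟩ := ht.exists_finset (n := 4 * 2 ^ i) (by omega)
  rcases hl s t Zs Zt hZs hZt (hcs.trans hct.symm) with h | h
  · refine absurd h (not_hasDisjointPaths (stripSeparator i) ?_ ?_)
    · rw [hcs]
      exact card_stripSeparator_lt i
    · intro a ha b hb w
      have ha' := hps a ha
      have hb' := hpt b hb
      exact exists_mem_stripSeparator i w ⟨ha'.1, ha'.2.2⟩ (by omega)
  · rwa [hcs] at h

/-- Some edge of the decomposition tree separates the bags capturing the first `i + 1` strips from
the bag capturing the next strip. -/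
lemma exists_edge_of_isLean (h : IsTreeDecomposition stripGraph T bag)
    (hl : IsLean stripGraph T bag) {t : ℕ → N} (ht : ∀ j, MeetsSquare (bag (t j)) j) {u v : N}
    (hu : (7, -1) ∈ bag u) (hv : (7, 0) ∈ bag v) (i : ℕ) :
    ∃ e : Sym2 N, ¬ SameSide T e u v ∧ (∀ j ≤ i, SameSide T e u (t j)) ∧
      SameSide T e v (t (i + 1)) := by
  obtain ⟨p, hp, d, hd, hcard⟩ := hl.exists_dart (ht i) (ht (i + 1))
  have hfin : (bag d.fst ∩ bag d.snd).Finite :=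
    Set.encard_lt_top_iff.1 (hcard.trans (ENat.natCast_lt_top _))
  obtain ⟨X, hX⟩ := hfin.exists_finset_coe
  rw [← hX, Set.encard_coe_eq_coe_finsetCard, Nat.cast_lt] at hcard
  have he : ¬ SameSide T s(d.fst, d.snd) (t i) (t (i + 1)) :=
    (not_sameSide_iff h.isTree hp _).2 (List.mem_map.2 ⟨d, hd, rfl⟩)
  obtain ⟨D, hD⟩ := exists_heightLt X
  have hside : ∀ {a b s r}, Linked stripGraph (X : Set (ℕ × ℤ)) a b → a ∈ bag s → b ∈ bag r →
      SameSide T s(d.fst, d.snd) s r := fun hab ha hb =>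
    h.sameSide_of_linked (hX ▸ hab) ha hb
  obtain ⟨b₁, hb₁, hl₁⟩ := (ht i).exists_linkedDeep hD
    ((Finset.card_filter_le _ _).trans_lt (by omega))
  obtain ⟨b₂, hb₂, hl₂⟩ := (ht (i + 1)).exists_linkedDeep hD
    ((Finset.card_filter_le _ _).trans_lt (by omega))
  have hcut : ¬ LinkedDeep X D i (7 * 2 ^ (i + 1), -(D : ℤ)) := fun hc =>
    he (hside (hl₁.trans (hl₂.trans hc).symm) hb₁ hb₂)
  obtain ⟨hv', hu'⟩ := hD.linkedDeep_of_cut hcard hcut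
  have hleft : ∀ j ≤ i, SameSide T s(d.fst, d.snd) u (t j) := by
    intro j hj
    -- For small `j` all of `X` may be too large to compare with the square; `h2` counts only the
    -- part of `X` left of column `14 * 2 ^ j`.
    obtain ⟨h1, h2⟩ := hu' j hj
    obtain ⟨b, hb, hbl⟩ := (ht j).exists_linkedDeep hD (h2.trans_le (by omega))
    exact hside (h1.trans hbl.symm) hu hb
  have hright : SameSide T s(d.fst, d.snd) v (t (i + 1)) := hside (hv'.trans hl₂.symm) hv hb₂
  exact ⟨_, fun huv => he ((hleft i le_rfl).symm.trans (huv.trans hright)), hleft, hright⟩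

theorem stripGraph_not_isLean (h : IsTreeDecomposition stripGraph T bag) :
    ¬ IsLean stripGraph T bag := by
  intro hl
  choose t ht using h.exists_meetsSquare
  obtain ⟨u, hu⟩ := h.vertex_mem (7, -1)
  obtain ⟨v, hv⟩ := h.vertex_mem (7, 0)
  choose e huv hleft hright using exists_edge_of_isLean h hl ht hu hv
  obtain ⟨p, hp⟩ := exists_isPath h.isTree u v
  -- The node `t (i + 1)` lies on the side of `u` for `e j`, but on the side of `v` for `e i`.
  have hlt : ∀ i j, i < j → e i ≠ e j := fun i j hij heq =>
    huv i (SameSide.trans (heq ▸ hleft j (i + 1) hij) (hright i).symm)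
  have hinj : Function.Injective e := by
    intro i j hij
    by_contra hne
    rcases lt_or_gt_of_ne hne with h' | h'
    exacts [hlt i j h' hij, hlt j i h' hij.symm]
  exact Set.infinite_range_of_injective hinj ((List.finite_toSet p.edges).subset
    (Set.range_subset_iff.2 fun i => (not_sameSide_iff h.isTree hp _).1 (huv i)))

end Main

end LeanTD

theorem mainTheorem1 :
    ∃ (V : Type) (G : SimpleGraph V),
      LeanTD.IsPlanar G ∧ LeanTD.IsLocallyFinite G ∧ G.Connected ∧
      LeanTD.HasFiniteTreeWidth G ∧
      ¬ ∃ (N : Type u) (T : SimpleGraph N) (bag : N → Set V),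
          LeanTD.IsTreeDecomposition G T bag ∧ LeanTD.IsLean G T bag := by
  refine ⟨ℕ × ℤ, LeanTD.stripGraph, LeanTD.stripGraph_isGridSubgraph.isPlanar,
    LeanTD.stripGraph_isGridSubgraph.isLocallyFinite, LeanTD.stripGraph_connected,
    LeanTD.stripGraph_isGridSubgraph.hasFiniteTreeWidth, ?_⟩
  rintro ⟨N, T, bag, h, hl⟩
  exact LeanTD.stripGraph_not_isLean h hl
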